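/- Let $k$ be a field of characteristic $p>0$, let $K$ be an abstract simplicial complex on finitely many vertices $x_1,\dots,x_n$ (the empty set is a face), and let $R=k[x_1,\dots,x_n]/I_K$ be its Stanley–Reisner ring, where $I_K$ is generated by the square-free monomials $\prod_{x_i\in\sigma}x_i$ with $\sigma\notin K$. Let $D(R)\subset \operatorname{End}_k(R)$ be the ring of $k$-linear differential operators on $R$. For $\sigma\subset\{x_1,\dots,x_n\}$ put $st(\sigma)=\{\tau\in K\mid \tau\cup\sigma\in K\}$. For $q=p^r$, $r\in\mathbb N$, let $R^q\subset R$ be the $k$-subalgebra generated by the $q$-th powers of elements of $R$ (when $k$ is perfect, this is the ring of $q$-th powers). For $\sigma\in K$ let $M^q_{st(\sigma)}$ be the $R^q$-submodule of $R$ generated by the monomials $x^a$ with $0\le a_i<q$ for all $i$ whose support $\operatorname{supp}(a)=\{x_i\mid a_i\ne0\}$ is a face of $K$ with $st(\operatorname{supp}(a))=st(\sigma)$. Then $R$ is the direct sum of the $M^q_{st(\sigma)}$ over all distinct stars, so that $$\operatorname{End}_{R^q}(R)=\bigoplus_{st(\alpha),\,st(\beta)}\operatorname{Hom}_{R^q}\bigl(M^q_{st(\alpha)},M^q_{st(\beta)}\bigr),$$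 and $D(R)=\bigcup_q \operatorname{End}_{R^q}(R)$. Let $J_q(st(\alpha),st(\beta))$ be the two-sided ideal of $D(R)$ generated by the block $\operatorname{Hom}_{R^q}(M^q_{st(\alpha)},M^q_{st(\beta)})$, let $J(st(\alpha),st(\beta))=\sum_{q}J_q(st(\alpha),st(\beta))$, and write $J(st(\sigma))=J(st(\sigma),st(\sigma))$. Theorem. The ideals $J(st(\sigma))$, $\sigma\in K$, generate the lattice of two-sided ideals of $D(R)$ by sums and intersections: every two-sided ideal of $D(R)$ is obtained from the ideals $J(st(\sigma))$ and the zero ideal (the empty sum) by finitely many sums and intersections. Moreover, for all $\sigma,\tau\in K$, $J(st(\sigma))\cap J(st(\tau))=J(st(\sigma\cup\tau))$ if $\sigma\cup\tau$ is a face of $K$, and $J(st(\sigma))\cap J(st(\tau))=0$ otherwise. -/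

import Mathlib

namespace StanleyReisner

/-- An abstract simplicial complex on the finite vertex set `V`.  The empty face always belongs to
the complex; a vertex need not be a face. -/
structure Complex (V : Type*) where
  faces : Set (Finset V)
  empty_mem : ∅ ∈ faces
  down_closed : ∀ ⦃σ τ : Finset V⦄, σ ∈ faces → τ ⊆ σ → τ ∈ faces

/-- The closed star `st(σ, K) = {τ ∈ K | τ ∪ σ ∈ K}`.  It is the empty set when `σ` is not a face
of `K`. -/
def star {V : Type*} [DecidableEq V] (K : Complex V) (σ : Finset V) : Set (Finset V) :=
  {τ | τ ∈ K.faces ∧ τ ∪ σ ∈ K.faces}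

section FaceRing

variable (k : Type*) [Field k] {V : Type*}

/-- The face ideal `I_K`, generated by the square-free monomials of the non-faces of `K`. -/
noncomputable def faceIdeal (K : Complex V) : Ideal (MvPolynomial V k) :=
  Ideal.span {f | ∃ σ : Finset V, σ ∉ K.faces ∧ f = ∏ i ∈ σ, MvPolynomial.X i}

/-- The Stanley-Reisner ring (face ring) `R_K = k[x_i | i ∈ V] / I_K`. -/
abbrev FaceRing (K : Complex V) : Type _ := MvPolynomial V k ⧸ faceIdeal k K

/-- The class in `R_K` of the monomial `x^a`. -/
noncomputable def mono (K : Complex V) (a : V →₀ ℕ) : FaceRing k K :=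
  Ideal.Quotient.mk (faceIdeal k K) (MvPolynomial.monomial a 1)

end FaceRing

section DifferentialOperators

variable (k : Type*) [CommRing k] (R : Type*) [CommRing R] [Algebra k R]

/-- `IsDiffOp k R n φ` : the `k`-linear endomorphism `φ` of `R` is a differential operator of order
at most `n`. Order `≤ 0` means multiplication by an element of `R`; order `≤ n + 1` means that every
commutator `[φ, r]`, `r ∈ R`, has order `≤ n`. -/
def IsDiffOp : ℕ → Module.End k R → Prop
  | 0, φ => ∃ r : R, φ = LinearMap.mulLeft k r
  | n + 1, φ => ∀ r : R, IsDiffOp n (φ * LinearMap.mulLeft k r - LinearMap.mulLeft k r * φ)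

variable {k R}

theorem IsDiffOp.succ : ∀ {n : ℕ} {φ : Module.End k R}, IsDiffOp k R n φ → IsDiffOp k R (n + 1) φ
  | 0, φ, ⟨s, hs⟩ => fun r => ⟨0, by subst hs; ext x; simp [mul_left_comm]⟩
  | _ + 1, _, h => fun r => (h r).succ

theorem IsDiffOp.mono {m n : ℕ} (h : m ≤ n) {φ : Module.End k R} (hφ : IsDiffOp k R m φ) :
    IsDiffOp k R n φ := by
  induction h with
  | refl => exact hφ
  | step _ ih => exact ih.succ

theorem IsDiffOp.add : ∀ {n : ℕ} {φ ψ : Module.End k R}, IsDiffOp k R n φ → IsDiffOp k R n ψ →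
    IsDiffOp k R n (φ + ψ)
  | 0, φ, ψ, ⟨s, hs⟩, ⟨t, ht⟩ => ⟨s + t, by subst hs ht; ext x; simp [add_mul]⟩
  | n + 1, φ, ψ, hφ, hψ => fun r => by
      have := (hφ r).add (hψ r)
      convert this using 1
      noncomm_ring

theorem IsDiffOp.mul : ∀ {N m n : ℕ}, m + n = N → ∀ {φ ψ : Module.End k R}, IsDiffOp k R m φ →
    IsDiffOp k R n ψ → IsDiffOp k R (m + n) (φ * ψ) := by
  have key : ∀ (φ ψ : Module.End k R) (r : R),
      φ * ψ * LinearMap.mulLeft k r - LinearMap.mulLeft k r * (φ * ψ) =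
      φ * (ψ * LinearMap.mulLeft k r - LinearMap.mulLeft k r * ψ) +
      (φ * LinearMap.mulLeft k r - LinearMap.mulLeft k r * φ) * ψ := by
    intro φ ψ r; simp only [mul_sub, sub_mul, mul_assoc]; abel
  have comm0 : ∀ (s r : R), LinearMap.mulLeft k s * LinearMap.mulLeft k r -
      LinearMap.mulLeft k r * LinearMap.mulLeft k s = (0 : Module.End k R) := by
    intro s r; ext x; simp [mul_left_comm]
  intro N
  induction N with
  | zero =>
    intro m n h φ ψ hφ hψ
    obtain ⟨rfl, rfl⟩ : m = 0 ∧ n = 0 := by omega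
    obtain ⟨s, rfl⟩ := hφ
    obtain ⟨t, rfl⟩ := hψ
    exact ⟨s * t, by ext x; simp⟩
  | succ N ih =>
    intro m n h φ ψ hφ hψ
    rw [h]
    intro r
    rw [key]
    rcases m with _ | m
    · rcases n with _ | n
      · omega
      · obtain ⟨s, rfl⟩ := hφ
        rw [comm0, zero_mul, add_zero]
        exact (ih (m := 0) (n := n) (by omega) ⟨s, rfl⟩ (hψ r)).mono (by omega)
    · rcases n with _ | n
      · obtain ⟨t, rfl⟩ := hψ
        rw [comm0, mul_zero, zero_add]
        exact (ih (m := m) (n := 0) (by omega) (hφ r) ⟨t, rfl⟩).mono (by omega)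
      · exact ((ih (m := m + 1) (n := n) (by omega) hφ (hψ r)).mono (by omega)).add
          ((ih (m := m) (n := n + 1) (by omega) (hφ r) hψ).mono (by omega))

variable (k R)

/-- The ring `D_k(R)` of `k`-linear differential operators on `R`, a subalgebra of `End_k(R)`. -/
def diffOps : Subalgebra k (Module.End k R) where
  carrier := {φ | ∃ n, IsDiffOp k R n φ}
  mul_mem' := by
    rintro φ ψ ⟨m, hm⟩ ⟨n, hn⟩
    exact ⟨m + n, hm.mul rfl hn⟩
  add_mem' := by
    rintro φ ψ ⟨m, hm⟩ ⟨n, hn⟩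
    exact ⟨max m n, (hm.mono (le_max_left _ _)).add (hn.mono (le_max_right _ _))⟩
  algebraMap_mem' := fun c => ⟨0, algebraMap k R c, by
    ext x; simp [Module.algebraMap_end_apply, Algebra.smul_def]⟩

end DifferentialOperators

section Frobenius

variable (k : Type*) [Field k] {V : Type*}

/-- The subring `R^q` of `R = R_K`: the `k`-subalgebra generated by the `q`-th powers.  If `k` is
perfect of characteristic `p` and `q = p ^ r`, it consists of the `q`-th powers themselves, see
`mem_powSubring_iff`. -/
noncomputable def powSubring (K : Complex V) (q : ℕ) : Subalgebra k (FaceRing k K) :=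
  Algebra.adjoin k (Set.range fun f : FaceRing k K => f ^ q)

theorem mem_powSubring_iff (p : ℕ) [Fact p.Prime] [CharP k p] [PerfectRing k p] (K : Complex V)
    (r : ℕ) (s : FaceRing k K) : s ∈ powSubring k K (p ^ r) ↔ ∃ f, f ^ p ^ r = s := by
  constructor
  · intro hs
    induction hs using Algebra.adjoin_induction with
    | mem x hx => exact hx
    | algebraMap c =>
      obtain ⟨d, hd⟩ := (bijective_iterateFrobenius (R := k) p r).2 c
      exact ⟨algebraMap k _ d, by rw [← map_pow, ← hd, iterateFrobenius_def]⟩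
    | add x y _ _ hx hy =>
      obtain ⟨f, rfl⟩ := hx
      obtain ⟨g, rfl⟩ := hy
      obtain ⟨f, rfl⟩ := Ideal.Quotient.mk_surjective f
      obtain ⟨g, rfl⟩ := Ideal.Quotient.mk_surjective g
      exact ⟨Ideal.Quotient.mk _ (f + g), by
        rw [← map_pow, ← map_pow, ← map_pow, ← map_add, add_pow_char_pow]⟩
    | mul x y _ _ hx hy =>
      obtain ⟨f, rfl⟩ := hx
      obtain ⟨g, rfl⟩ := hy
      exact ⟨f * g, mul_pow _ _ _⟩
  · rintro ⟨f, rfl⟩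
    exact Algebra.subset_adjoin ⟨f, rfl⟩

variable [DecidableEq V]

/-- The summand `M^q_L` of `R` as an `R^q`-module, for a star `L` of `K`: the sum of the submodules
`R^q · x^a` over all monomials `x^a` with exponents `< q` whose support is a face with star `L`.
As `R^q · x^a ≅ R^q_L` for each such `a`, this is the module `(R^q_L)^{m_L(q)}`, and `R` is the
direct sum of the `M^q_L` over all stars `L`. -/
noncomputable def starModule (K : Complex V) (q : ℕ) (L : Set (Finset V)) :
    Submodule (powSubring k K q) (FaceRing k K) :=
  Submodule.span _
    {f | ∃ a : V →₀ ℕ, (∀ i, a i < q) ∧ a.support ∈ K.faces ∧ star K a.support = L ∧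
      f = mono k K a}

/-- The block `Hom_{R^q}(M^q_L, M^q_L')` of
`End_{R^q}(R) = ⨁_{L, L'} Hom_{R^q}(M^q_L, M^q_L')`: the `R^q`-linear endomorphisms of `R` that
take values in `M^q_L'` and vanish on every summand `M^q_N` with `N ≠ L`, regarded as `k`-linear
maps. -/
noncomputable def homBlock (K : Complex V) (q : ℕ) (L L' : Set (Finset V)) :
    Set (Module.End k (FaceRing k K)) :=
  {φ | ∃ ψ : Module.End (powSubring k K q) (FaceRing k K), φ = ψ.restrictScalars k ∧
    (∀ f, ψ f ∈ starModule k K q L') ∧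
    ∀ σ ∈ K.faces, star K σ ≠ L → ∀ f ∈ starModule k K q (star K σ), ψ f = 0}

/-- `J_q(L, L')`: the two-sided ideal of `D(R)` generated by the block
`Hom_{R^q}(M^q_L, M^q_L')`.  (The ring `D(R)` is the union of the subrings `End_{R^q}(R)` of
`End_k(R)`, so every element of the block is an element of `D(R)`.) -/
noncomputable def idealJq (K : Complex V) (q : ℕ) (L L' : Set (Finset V)) :
    TwoSidedIdeal (diffOps k (FaceRing k K)) :=
  TwoSidedIdeal.span {d | (d : Module.End k (FaceRing k K)) ∈ homBlock k K q L L'}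

/-- `J(L, L') = ∑_q J_q(L, L')`, the sum over all powers `q = p ^ r`, `r ∈ ℕ`. -/
noncomputable def idealJ₂ (p : ℕ) (K : Complex V) (L L' : Set (Finset V)) :
    TwoSidedIdeal (diffOps k (FaceRing k K)) :=
  ⨆ r : ℕ, idealJq k K (p ^ r) L L'

/-- `J(L) = J(L, L)`. -/
noncomputable def idealJ (p : ℕ) (K : Complex V) (L : Set (Finset V)) :
    TwoSidedIdeal (diffOps k (FaceRing k K)) :=
  idealJ₂ k p K L L

end Frobenius

end StanleyReisner

/-! Write st(e) for the star of supp(e), and let q = p ^ s. If φ commutes with multiplication by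
q-th powers and x^f occurs in φ(x^e), then st(f) ⊆ st(e) (`PowLinear.star_subset`). Conversely, each
pair with st(f) ⊆ st(e) and e reduced mod q gives an operator `monoOp`, and these compose like
matrix units. In characteristic p every differential operator is linear over some R^q and
conversely, so D(R) is spanned by the `monoOp`s, with q varying.

A two-sided ideal is therefore controlled by the stars of the monomials occurring in values of its
members. J(st(σ)) consists of all operators whose output monomials have star inside st(σ)
(`idealJ_eq_rangeIdeal`). If x^f occurs in a value of some member of I, then J(st(f)) ⊆ I
(`idealJ_le_of_faceCoeff_ne_zero`). Hence I is the sum of the finitely many J(st(σ)) it contains.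
The intersection formulas come from the equivalence of st(g) ⊆ st(σ) ∩ st(τ) with st(g) ⊆ st(σ ∪ τ)
for a face g; since g lies in its own star, this forces σ ∪ τ to be a face. -/

namespace StanleyReisner

open MvPolynomial

/-! ### Exponent vectors modulo q, and inclusions of stars -/

section Exponents

variable {V : Type*}

/-- Componentwise remainder of an exponent vector. -/
noncomputable def expMod (q : ℕ) (e : V →₀ ℕ) : V →₀ ℕ := e.mapRange (· % q) (Nat.zero_mod q)

/-- Componentwise quotient of an exponent vector. -/
noncomputable def expDiv (q : ℕ) (e : V →₀ ℕ) : V →₀ ℕ := e.mapRange (· / q) (Nat.zero_div q)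

theorem expMod_add_expDiv (q : ℕ) (e : V →₀ ℕ) : expMod q e + q • expDiv q e = e := by
  ext i
  simp [expMod, expDiv, Nat.mod_add_div]

theorem expMod_lt {q : ℕ} (hq : 0 < q) (e : V →₀ ℕ) (i : V) : expMod q e i < q := by
  simpa [expMod] using Nat.mod_lt _ hq

theorem expMod_of_lt {q : ℕ} {a : V →₀ ℕ} (ha : ∀ i, a i < q) : expMod q a = a := by
  ext i
  simp [expMod, Nat.mod_eq_of_lt (ha i)]

theorem expDiv_of_lt {q : ℕ} {a : V →₀ ℕ} (ha : ∀ i, a i < q) : expDiv q a = 0 := by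
  ext i
  simp [expDiv, Nat.div_eq_of_lt (ha i)]

theorem expMod_smul_add (q : ℕ) (d e : V →₀ ℕ) : expMod q (q • d + e) = expMod q e := by
  ext i
  simp [expMod]

theorem expDiv_smul_add {q : ℕ} (hq : 0 < q) (d e : V →₀ ℕ) :
    expDiv q (q • d + e) = d + expDiv q e := by
  ext i
  simp [expDiv, Nat.mul_add_div hq]

variable [DecidableEq V]

/-- The exponent vector of the square-free monomial with support `σ`. -/
noncomputable def squareFree (σ : Finset V) : V →₀ ℕ := ∑ i ∈ σ, Finsupp.single i 1

theorem squareFree_apply (σ : Finset V) (i : V) : squareFree σ i = if i ∈ σ then 1 else 0 := by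
  simp [squareFree, Finsupp.finsetSum_apply, Finsupp.single_apply]

theorem support_squareFree (σ : Finset V) : (squareFree σ).support = σ := by
  ext i
  simp [squareFree_apply]

theorem support_add_smul {q : ℕ} (hq : 0 < q) (a d : V →₀ ℕ) :
    (a + q • d).support = a.support ∪ d.support := by
  ext i
  simp only [Finsupp.mem_support_iff, Finset.mem_union, Finsupp.add_apply, Finsupp.smul_apply,
    smul_eq_mul, ne_eq, Nat.add_eq_zero_iff, mul_eq_zero]
  grind

theorem support_add_nat (a d : V →₀ ℕ) : (a + d).support = a.support ∪ d.support := by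
  simpa using support_add_smul one_pos a d

theorem mem_star_comm {K : Complex V} {σ τ : Finset V} :
    τ ∈ star K σ ↔ τ ∪ σ ∈ K.faces :=
  ⟨fun h => h.2, fun h => ⟨K.down_closed h Finset.subset_union_left, h⟩⟩

theorem star_mono_right {K : Complex V} {σ τ : Finset V} (h : σ ⊆ τ) : star K τ ⊆ star K σ :=
  fun _ hρ => mem_star_comm.2 (K.down_closed (mem_star_comm.1 hρ) (Finset.union_subset_union_right h))

/-- κ ∈ st(σ ∪ ρ) means exactly κ ∪ ρ ∈ st(σ), so the inclusion can be applied to κ ∪ ρ. -/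
theorem star_subset_union {K : Complex V} {σ τ ρ : Finset V} (h : star K σ ⊆ star K τ) :
    star K (σ ∪ ρ) ⊆ star K (τ ∪ ρ) := by
  intro κ hκ
  rw [mem_star_comm] at hκ ⊢
  have : κ ∪ ρ ∈ star K σ := mem_star_comm.2 (by convert hκ using 1; ac_rfl)
  convert mem_star_comm.1 (h this) using 1
  ac_rfl

theorem star_union_eq {K : Complex V} {σ τ : Finset V} (h : star K σ ⊆ star K τ) :
    star K (σ ∪ τ) = star K σ := by
  refine (star_mono_right Finset.subset_union_left).antisymm ?_
  simpa [Finset.union_comm] using star_subset_union (ρ := σ) h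

theorem union_mem_of_star_subset {K : Complex V} {σ τ : Finset V} (hσ : σ ∈ K.faces)
    (h : star K σ ⊆ star K τ) : σ ∪ τ ∈ K.faces :=
  mem_star_comm.1 (h (mem_star_comm.2 (by simpa)))

theorem mem_faces_of_star_subset {K : Complex V} {σ τ : Finset V} (hσ : σ ∈ K.faces)
    (h : star K σ ⊆ star K τ) : τ ∈ K.faces :=
  K.down_closed (union_mem_of_star_subset hσ h) Finset.subset_union_right

end Exponents

/-! ### The monomial basis of the face ring -/

section Coefficients

variable {k : Type*} [Field k] {V : Type*} (K : Complex V)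

theorem mono_mul_mono (a b : V →₀ ℕ) : mono k K a * mono k K b = mono k K (a + b) := by
  rw [mono, mono, mono, ← map_mul, monomial_mul, one_mul]

theorem mono_pow (a : V →₀ ℕ) (n : ℕ) : mono k K a ^ n = mono k K (n • a) := by
  rw [mono, mono, ← map_pow, monomial_pow, one_pow]

theorem prod_X_eq_monomial (σ : Finset V) :
    ∏ i ∈ σ, (X i : MvPolynomial V k) = monomial (squareFree σ) 1 := by
  simp [squareFree, monomial_sum_one, X]

variable [DecidableEq V]

/-- Every divisor of a face monomial is a face monomial, so no face monomial is a multiple of a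
generator. This makes coefficients at faces well defined on the quotient. -/
theorem coeff_eq_zero_of_mem_faceIdeal {f : MvPolynomial V k} (hf : f ∈ faceIdeal k K)
    {e : V →₀ ℕ} (he : e.support ∈ K.faces) : coeff e f = 0 := by
  induction hf using Submodule.span_induction generalizing e with
  | mem f hf =>
    obtain ⟨σ, hσ, rfl⟩ := hf
    rw [prod_X_eq_monomial, coeff_monomial, if_neg]
    rintro rfl
    exact hσ (by rwa [support_squareFree] at he)
  | zero => simp
  | add f g _ _ hf hg => simp [hf he, hg he]
  | smul g f _ hf =>
    rw [smul_eq_mul, coeff_mul]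
    refine Finset.sum_eq_zero fun x hx => ?_
    rw [hf, mul_zero]
    rw [← Finset.HasAntidiagonal.mem_antidiagonal.1 hx, support_add_nat] at he
    exact K.down_closed he Finset.subset_union_right

theorem mono_eq_zero {e : V →₀ ℕ} (he : e.support ∉ K.faces) : mono k K e = 0 := by
  rw [mono, Ideal.Quotient.eq_zero_iff_mem]
  have h : (monomial e 1 : MvPolynomial V k) =
      monomial (e - squareFree e.support) 1 * ∏ i ∈ e.support, X i := by
    rw [prod_X_eq_monomial, monomial_mul, one_mul, tsub_add_cancel_of_le]
    intro i
    rw [squareFree_apply]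
    split_ifs with h
    · exact Nat.one_le_iff_ne_zero.2 (Finsupp.mem_support_iff.1 h)
    · exact Nat.zero_le _
  rw [h]
  exact Ideal.mul_mem_left _ _ (Ideal.subset_span ⟨_, he, rfl⟩)

open Classical in
/-- The coefficient of a face monomial, as a linear functional on the face ring; zero for exponent
vectors whose support is not a face. -/
noncomputable def faceCoeff (e : V →₀ ℕ) : FaceRing k K →ₗ[k] k :=
  if he : e.support ∈ K.faces then
    Submodule.liftQ ((faceIdeal k K).restrictScalars k) (lcoeff k e)
        (fun _ hf => coeff_eq_zero_of_mem_faceIdeal K hf he) ∘ₗ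
      (Submodule.Quotient.restrictScalarsEquiv k (faceIdeal k K)).symm.toLinearMap
  else 0

variable {K}

theorem faceCoeff_mk {e : V →₀ ℕ} (he : e.support ∈ K.faces) (f : MvPolynomial V k) :
    faceCoeff K e (Ideal.Quotient.mk _ f) = coeff e f := by
  rw [faceCoeff, dif_pos he]
  rfl

theorem faceCoeff_eq_zero {e : V →₀ ℕ} (he : e.support ∉ K.faces) (x : FaceRing k K) :
    faceCoeff K e x = 0 := by
  rw [faceCoeff, dif_neg he, LinearMap.zero_apply]

theorem mem_faces_of_faceCoeff_ne_zero {e : V →₀ ℕ} {x : FaceRing k K}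
    (h : faceCoeff K e x ≠ 0) : e.support ∈ K.faces :=
  not_imp_comm.1 (fun he => faceCoeff_eq_zero he x) h

theorem faceCoeff_mono {e : V →₀ ℕ} (he : e.support ∈ K.faces) (a : V →₀ ℕ) :
    faceCoeff K e (mono k K a) = if a = e then 1 else 0 := by
  rw [mono, faceCoeff_mk he, coeff_monomial]

theorem faceCoeff_mono_of_ne {e a : V →₀ ℕ} (h : a ≠ e) :
    faceCoeff K e (mono k K a) = 0 := by
  by_cases he : e.support ∈ K.faces
  · rw [faceCoeff_mono he, if_neg h]
  · exact faceCoeff_eq_zero he _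

theorem exists_eq_sum_mono (x : FaceRing k K) :
    ∃ s : Finset (V →₀ ℕ), (∀ e ∈ s, faceCoeff K e x ≠ 0) ∧ (∀ e, faceCoeff K e x ≠ 0 → e ∈ s) ∧
      x = ∑ e ∈ s, faceCoeff K e x • mono k K e := by
  classical
  obtain ⟨f, rfl⟩ := Ideal.Quotient.mk_surjective x
  have h0 : ∀ e, faceCoeff K e (Ideal.Quotient.mk _ f) ≠ 0 → e ∈ f.support := fun e he => by
    rw [faceCoeff_mk (mem_faces_of_faceCoeff_ne_zero he)] at he
    exact mem_support_iff.2 he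
  refine ⟨f.support.filter fun e => faceCoeff K e (Ideal.Quotient.mk _ f) ≠ 0,
    fun e he => (Finset.mem_filter.1 he).2, fun e he => Finset.mem_filter.2 ⟨h0 e he, he⟩, ?_⟩
  rw [Finset.sum_filter_of_ne fun e _ h => left_ne_zero_of_smul h]
  conv_lhs => rw [f.as_sum, map_sum]
  refine Finset.sum_congr rfl fun e _ => ?_
  by_cases he : e.support ∈ K.faces
  · rw [faceCoeff_mk he, mono, ← mul_one (coeff e f), ← smul_eq_mul, ← smul_monomial, smul_eq_mul,
      mul_one]
    rfl
  · rw [mono_eq_zero K he, smul_zero, ← mul_one (coeff e f), ← smul_eq_mul, ← smul_monomial]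
    change coeff e f • mono k K e = 0
    rw [mono_eq_zero K he, smul_zero]

theorem span_range_mono : Submodule.span k (Set.range (mono k K)) = ⊤ := by
  refine eq_top_iff.2 fun x _ => ?_
  obtain ⟨s, -, -, hx⟩ := exists_eq_sum_mono x
  rw [hx]
  exact Submodule.sum_mem _ fun e _ => Submodule.smul_mem _ _ (Submodule.subset_span ⟨e, rfl⟩)

theorem hom_ext {M : Type*} [AddCommMonoid M] [Module k M] {φ ψ : FaceRing k K →ₗ[k] M}
    (h : ∀ e, φ (mono k K e) = ψ (mono k K e)) : φ = ψ :=
  LinearMap.ext_on_range span_range_mono h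

theorem faceCoeff_add_mono_mul {c e : V →₀ ℕ} (h : (c + e).support ∈ K.faces)
    (x : FaceRing k K) : faceCoeff K (c + e) (mono k K c * x) = faceCoeff K e x := by
  obtain ⟨f, rfl⟩ := Ideal.Quotient.mk_surjective x
  rw [mono, ← map_mul, faceCoeff_mk h, faceCoeff_mk, coeff_monomial_mul, one_mul]
  rw [support_add_nat] at h
  exact K.down_closed h Finset.subset_union_right

variable (k K)

/-- The basis of the face ring formed by the monomials whose support is a face. -/
noncomputable def monoBasis :
    Module.Basis {e : V →₀ ℕ // e.support ∈ K.faces} k (FaceRing k K) :=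
  Module.Basis.mk (v := fun e => mono k K e.1)
    (LinearIndependent.of_pairwise_dual_eq_zero_one _ (fun e => faceCoeff K e.1)
      (fun e f hef => faceCoeff_mono_of_ne fun h => hef (Subtype.ext h.symm))
      (fun e => by rw [faceCoeff_mono e.2, if_pos rfl]))
    (fun x _ => by
      obtain ⟨s, hs, -, hx⟩ := exists_eq_sum_mono x
      rw [hx]
      exact Submodule.sum_mem _ fun e he => Submodule.smul_mem _ _
        (Submodule.subset_span ⟨⟨e, mem_faces_of_faceCoeff_ne_zero (hs e he)⟩, rfl⟩))

variable {k K}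

theorem monoBasis_apply (e : {e : V →₀ ℕ // e.support ∈ K.faces}) :
    monoBasis k K e = mono k K e.1 := by
  rw [monoBasis, Module.Basis.mk_apply]

instance : Nontrivial (FaceRing k K) := by
  refine ⟨mono k K 0, 0, fun h => ?_⟩
  have := congrArg (faceCoeff K 0) h
  rw [faceCoeff_mono (by simpa using K.empty_mem), if_pos rfl, map_zero] at this
  exact one_ne_zero this

end Coefficients

/-! ### Differential operators in characteristic p are the operators linear over some R^q -/

section PowLinear

variable (k : Type*) [Field k] {R : Type*} [CommRing R] [Algebra k R]

/-- The inner derivation `φ ↦ [φ, r]` of `End_k(R)` defined by multiplication by `r`. -/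
noncomputable def commutator (r : R) : Module.End k (Module.End k R) :=
  LinearMap.mulRight k (LinearMap.mulLeft k r) - LinearMap.mulLeft k (LinearMap.mulLeft k r)

variable {k}

theorem commutator_apply (r : R) (φ : Module.End k R) :
    commutator k r φ = φ * LinearMap.mulLeft k r - LinearMap.mulLeft k r * φ := rfl

theorem commutator_apply_apply (r : R) (φ : Module.End k R) (x : R) :
    commutator k r φ x = φ (r * x) - r * φ x := rfl

theorem commute_commutator (r s : R) : Commute (commutator k r) (commutator k s) := by
  refine LinearMap.ext fun φ => LinearMap.ext fun x => ?_
  simp only [Module.End.mul_apply, commutator_apply_apply, mul_left_comm s r]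
  ring

theorem IsDiffOp.commutator_pow_eq_zero {n : ℕ} {φ : Module.End k R} (h : IsDiffOp k R n φ)
    (r : R) : (commutator k r ^ (n + 1)) φ = 0 := by
  induction n generalizing φ with
  | zero =>
    obtain ⟨s, rfl⟩ := h
    ext x
    simp [commutator_apply_apply, mul_left_comm]
  | succ n ih => rw [pow_succ, Module.End.mul_apply]; exact ih (h r)

/-- `φ` commutes with multiplication by all `q`-th powers. -/
def PowLinear (q : ℕ) (φ : Module.End k R) : Prop := ∀ r x : R, φ (r ^ q * x) = r ^ q * φ x

theorem PowLinear.of_dvd {q q' : ℕ} (h : q ∣ q') {φ : Module.End k R} (hφ : PowLinear q φ) :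
    PowLinear q' φ := by
  obtain ⟨m, rfl⟩ := h
  intro r x
  rw [mul_comm q, pow_mul]
  exact hφ _ x

theorem PowLinear.mul {q : ℕ} {φ ψ : Module.End k R} (hφ : PowLinear q φ) (hψ : PowLinear q ψ) :
    PowLinear q (φ * ψ) := fun r x => by
  rw [Module.End.mul_apply, hψ, hφ, Module.End.mul_apply]

/-- Inner derivations by commuting elements commute, so bracketing with x i lowers N i by one and
leaves the other conditions intact. The Leibniz rule passes from generators to all of R. -/
theorem isDiffOp_of_commutator_pow_eq_zero {V : Type*} [Fintype V] {x : V → R}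
    (hx : Algebra.adjoin k (Set.range x) = ⊤) (n : ℕ) (N : V → ℕ) (hN : ∑ i, N i ≤ n)
    (φ : Module.End k R) (hφ : ∀ i, (commutator k (x i) ^ (N i + 1)) φ = 0) :
    IsDiffOp k R n φ := by
  classical
  induction n generalizing N φ with
  | zero =>
    have h1 : ∀ r y : R, φ (r * y) = r * φ y := by
      intro r
      have hr : r ∈ Algebra.adjoin k (Set.range x) := hx ▸ Algebra.mem_top
      induction hr using Algebra.adjoin_induction with
      | mem r hr =>
        obtain ⟨i, rfl⟩ := hr
        have hi := hφ i
        have : N i = 0 := Finset.sum_eq_zero_iff.1 (Nat.le_zero.1 hN) i (Finset.mem_univ i)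
        rw [this, zero_add, pow_one] at hi
        exact fun y => sub_eq_zero.1 (DFunLike.congr_fun hi y)
      | algebraMap c =>
        intro y
        rw [← Algebra.smul_def, ← Algebra.smul_def, map_smul]
      | add a b _ _ ha hb => intro y; rw [add_mul, map_add, ha, hb, add_mul]
      | mul a b _ _ ha hb => intro y; rw [mul_assoc, ha, hb, mul_assoc]
    refine ⟨φ 1, LinearMap.ext fun r => ?_⟩
    rw [LinearMap.mulLeft_apply, mul_comm, ← h1, mul_one]
  | succ n ih =>
    intro r
    have hr : r ∈ Algebra.adjoin k (Set.range x) := hx ▸ Algebra.mem_top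
    have h0 : IsDiffOp k R n 0 := IsDiffOp.mono n.zero_le ⟨0, by simp⟩
    induction hr using Algebra.adjoin_induction with
    | mem r hr =>
      obtain ⟨i, rfl⟩ := hr
      rw [← commutator_apply]
      rcases Nat.eq_zero_or_pos (N i) with hi | hi
      · have := hφ i
        rw [hi, zero_add, pow_one] at this
        rwa [this]
      · refine ih (Function.update N i (N i - 1)) ?_ _ fun j => ?_
        · have h1 := Finset.sum_update_of_mem (Finset.mem_univ i) N (N i - 1)
          have h2 := Finset.add_sum_erase Finset.univ N (Finset.mem_univ i)
          rw [← Finset.sdiff_singleton_eq_erase] at h2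
          omega
        · rcases eq_or_ne j i with rfl | hj
          · rw [Function.update_self, Nat.sub_add_cancel hi, ← Module.End.mul_apply, ← pow_succ]
            exact hφ j
          · rw [Function.update_of_ne hj, ← Module.End.mul_apply,
              ((commute_commutator (x j) (x i)).pow_left _).eq, Module.End.mul_apply, hφ, map_zero]
    | algebraMap c =>
      convert h0
      refine LinearMap.ext fun y => ?_
      simp [← Algebra.smul_def]
    | add a b _ _ ha hb =>
      convert ha.add hb using 1
      refine LinearMap.ext fun y => ?_
      simp [add_mul]
      ring
    | mul a b _ _ ha hb =>
      have hl (c : R) : IsDiffOp k R 0 (LinearMap.mulLeft k c) := ⟨c, rfl⟩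
      have h1 : IsDiffOp k R n _ := IsDiffOp.mul (m := n) (n := 0) rfl ha (hl b)
      have h2 := (IsDiffOp.mul (m := 0) (n := n) rfl (hl a) hb).mono (zero_add n).le
      convert h1.add h2 using 1
      refine LinearMap.ext fun y => ?_
      simp [mul_sub]

variable (p : ℕ) [Fact p.Prime] [CharP k p] [Nontrivial R]

/-- Left and right multiplications commute, so the Frobenius identity applies to their difference.
-/
theorem commutator_pow_char_pow (r : R) (s : ℕ) :
    commutator k r ^ p ^ s = commutator k (r ^ p ^ s) := by
  have : CharP (Module.End k (Module.End k R)) p :=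
    charP_of_injective_algebraMap
      (FaithfulSMul.algebraMap_injective k (Module.End k (Module.End k R))) p
  refine (sub_pow_char_pow_of_commute (R := Module.End k (Module.End k R)) p s
    (LinearMap.commute_mulLeft_right (R := k) _ _).symm).trans ?_
  rw [commutator, LinearMap.pow_mulLeft, LinearMap.pow_mulRight, LinearMap.pow_mulLeft]

theorem exists_powLinear_of_mem_diffOps {φ : Module.End k R} (h : φ ∈ diffOps k R) :
    ∃ s : ℕ, PowLinear (p ^ s) φ := by
  obtain ⟨n, hn⟩ := h
  have hp : 1 < p := (Fact.out : p.Prime).one_lt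
  -- The exponent only has to satisfy n + 1 ≤ p ^ s, and s = n + 1 does.
  refine ⟨n + 1, fun r x => ?_⟩
  have h1 : n + 1 ≤ p ^ (n + 1) := (Nat.lt_pow_self hp).le
  have h2 : (commutator k r ^ p ^ (n + 1)) φ = 0 := by
    rw [← Nat.sub_add_cancel h1, pow_add, Module.End.mul_apply, hn.commutator_pow_eq_zero,
      map_zero]
  rw [commutator_pow_char_pow p] at h2
  exact sub_eq_zero.1 (DFunLike.congr_fun h2 x)

theorem mem_diffOps_of_commute_generators {V : Type*} [Fintype V] {x : V → R}
    (hx : Algebra.adjoin k (Set.range x) = ⊤) {s : ℕ} {φ : Module.End k R}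
    (hφ : ∀ i y, φ (x i ^ p ^ s * y) = x i ^ p ^ s * φ y) : φ ∈ diffOps k R := by
  have hp : 0 < p ^ s := pow_pos (Fact.out : p.Prime).pos _
  refine ⟨_, isDiffOp_of_commutator_pow_eq_zero hx _ (fun _ => p ^ s - 1) le_rfl φ fun i => ?_⟩
  rw [Nat.sub_add_cancel hp, commutator_pow_char_pow p]
  exact LinearMap.ext fun y => sub_eq_zero.2 (hφ i y)

theorem powLinear_of_commute_generators {V : Type*} {x : V → R}
    (hx : Algebra.adjoin k (Set.range x) = ⊤) {s : ℕ} {φ : Module.End k R}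
    (hφ : ∀ i y, φ (x i ^ p ^ s * y) = x i ^ p ^ s * φ y) : PowLinear (p ^ s) φ := by
  have : CharP R p := charP_of_injective_algebraMap (algebraMap k R).injective p
  intro r
  have hr : r ∈ Algebra.adjoin k (Set.range x) := hx ▸ Algebra.mem_top
  induction hr using Algebra.adjoin_induction with
  | mem r hr =>
    obtain ⟨i, rfl⟩ := hr
    exact hφ i
  | algebraMap c =>
    intro y
    rw [← map_pow, ← Algebra.smul_def, ← Algebra.smul_def, map_smul]
  | add a b _ _ ha hb => intro y; rw [add_pow_char_pow, add_mul, map_add, ha, hb, add_mul]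
  | mul a b _ _ ha hb => intro y; rw [mul_pow, mul_assoc, ha, hb, mul_assoc]

end PowLinear

/-! ### Operators on monomials and the star condition -/

section PowLinearFaceRing

variable {k : Type*} [Field k] {V : Type*} {K : Complex V}

theorem adjoin_range_mono_single :
    Algebra.adjoin k (Set.range fun i : V => mono k K (Finsupp.single i 1)) = ⊤ := by
  rw [Algebra.eq_top_iff]
  intro x
  obtain ⟨f, rfl⟩ := Ideal.Quotient.mk_surjective x
  induction f using MvPolynomial.induction_on with
  | C c => exact Subalgebra.algebraMap_mem _ c
  | add f g hf hg => rw [map_add]; exact Subalgebra.add_mem _ hf hg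
  | mul_X f i hf =>
    rw [map_mul]
    exact Subalgebra.mul_mem _ hf (Algebra.subset_adjoin ⟨i, rfl⟩)

theorem PowLinear.mono_smul_mul {q : ℕ} {φ : Module.End k (FaceRing k K)} (hφ : PowLinear q φ)
    (d : V →₀ ℕ) (x : FaceRing k K) : φ (mono k K (q • d) * x) = mono k K (q • d) * φ x := by
  rw [← mono_pow, hφ]

theorem PowLinear.mono_add_smul {q : ℕ} {φ : Module.End k (FaceRing k K)} (hφ : PowLinear q φ)
    (a d : V →₀ ℕ) : φ (mono k K (a + q • d)) = mono k K (q • d) * φ (mono k K a) := by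
  rw [add_comm, ← mono_mul_mono, hφ.mono_smul_mul]

theorem PowLinear.map_powSubring_mul {q : ℕ} {φ : Module.End k (FaceRing k K)}
    (hφ : PowLinear q φ) {s : FaceRing k K} (hs : s ∈ powSubring k K q) (x : FaceRing k K) :
    φ (s * x) = s * φ x := by
  induction hs using Algebra.adjoin_induction generalizing x with
  | mem s hs =>
    obtain ⟨r, rfl⟩ := hs
    exact hφ r x
  | algebraMap c => rw [← Algebra.smul_def, ← Algebra.smul_def, map_smul]
  | add a b _ _ ha hb => rw [add_mul, map_add, ha, hb, add_mul]
  | mul a b _ _ ha hb => rw [mul_assoc, ha, hb, mul_assoc]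

theorem mono_smul_mem_powSubring (q : ℕ) (d : V →₀ ℕ) :
    mono k K (q • d) ∈ powSubring k K q := by
  rw [← mono_pow]
  exact Algebra.subset_adjoin ⟨_, rfl⟩

variable [DecidableEq V]

theorem PowLinear.ext {q : ℕ} (hq : 0 < q) {φ ψ : Module.End k (FaceRing k K)}
    (hφ : PowLinear q φ) (hψ : PowLinear q ψ)
    (h : ∀ a : V →₀ ℕ, (∀ i, a i < q) → φ (mono k K a) = ψ (mono k K a)) : φ = ψ := by
  refine hom_ext fun e => ?_
  rw [← expMod_add_expDiv q e, hφ.mono_add_smul, hψ.mono_add_smul, h _ (expMod_lt hq e)]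

theorem exists_faceCoeff_ne_zero {x : FaceRing k K} {φ : Module.End k (FaceRing k K)}
    {g : V →₀ ℕ} (h : faceCoeff K g (φ x) ≠ 0) :
    ∃ f, faceCoeff K f x ≠ 0 ∧ faceCoeff K g (φ (mono k K f)) ≠ 0 := by
  obtain ⟨s, hs, -, hx⟩ := exists_eq_sum_mono x
  rw [hx, map_sum, map_sum] at h
  obtain ⟨f, hf, hf'⟩ := Finset.exists_ne_zero_of_sum_ne_zero h
  rw [map_smul, map_smul] at hf'
  exact ⟨f, hs f hf, right_ne_zero_of_smul hf'⟩

theorem exists_star_subset_of_faceCoeff_mul_ne_zero {r x : FaceRing k K} {g : V →₀ ℕ}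
    (h : faceCoeff K g (r * x) ≠ 0) :
    ∃ f, faceCoeff K f x ≠ 0 ∧ star K g.support ⊆ star K f.support := by
  obtain ⟨f, hf, hf'⟩ := exists_faceCoeff_ne_zero (φ := LinearMap.mulLeft k r) h
  rw [LinearMap.mulLeft_apply, mul_comm] at hf'
  obtain ⟨e, -, he⟩ := exists_faceCoeff_ne_zero (φ := LinearMap.mulLeft k (mono k K f)) hf'
  rw [LinearMap.mulLeft_apply, mono_mul_mono] at he
  have h0 : f + e = g := not_imp_comm.1 faceCoeff_mono_of_ne he
  rw [← h0, support_add_nat]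
  exact ⟨f, hf, star_mono_right Finset.subset_union_left⟩

/-- Let τ ∈ st(f) but τ ∉ st(e). Then x^(e + qτ) = 0, so x^(qτ) φ(x^e) = 0. Yet the coefficient of
x^(f + qτ) in it is that of x^f in φ(x^e), because τ ∪ supp(f) is a face. -/
theorem PowLinear.star_subset {q : ℕ} (hq : 0 < q) {φ : Module.End k (FaceRing k K)}
    (hφ : PowLinear q φ) {e f : V →₀ ℕ} (h : faceCoeff K f (φ (mono k K e)) ≠ 0) :
    star K f.support ⊆ star K e.support := by
  intro τ hτ
  by_contra hτe
  rw [mem_star_comm] at hτ hτe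
  refine h ?_
  rw [← faceCoeff_add_mono_mul (c := q • squareFree τ), ← hφ.mono_add_smul, mono_eq_zero K,
    map_zero, map_zero]
  · rwa [support_add_smul hq, support_squareFree, Finset.union_comm]
  · rwa [add_comm, support_add_smul hq, support_squareFree, Finset.union_comm]

end PowLinearFaceRing

/-! ### Matrix units of D(R) -/

section MonomialOperators

variable {k : Type*} [Field k] {V : Type*} [DecidableEq V] {K : Complex V}

open Classical in
variable (k K) in
/-- The operator with `x^(a + q d) ↦ x^(f + q d)` that kills all monomials whose exponent vector
is not congruent to `a` modulo `q`. -/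
noncomputable def monoOp (q : ℕ) (a f : V →₀ ℕ) : Module.End k (FaceRing k K) :=
  (monoBasis k K).constr k fun e =>
    if expMod q e.1 = a then mono k K (f + q • expDiv q e.1) else 0

open Classical in
-- The star inclusion extends the defining formula to monomials that vanish in R: if x^(a + qd) = 0
-- then x^(f + qd) = 0.
theorem monoOp_mono {q : ℕ} (hq : 0 < q) {a f : V →₀ ℕ}
    (h : star K f.support ⊆ star K a.support) (e : V →₀ ℕ) :
    monoOp k K q a f (mono k K e) =
      if expMod q e = a then mono k K (f + q • expDiv q e) else 0 := by
  by_cases he : e.support ∈ K.faces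
  · rw [← monoBasis_apply ⟨e, he⟩, monoOp, Module.Basis.constr_basis]
  · rw [mono_eq_zero K he, map_zero]
    split_ifs with h1
    · rw [mono_eq_zero]
      refine fun h2 => he ?_
      rw [support_add_smul hq, Finset.union_comm] at h2
      have h3 := mem_star_comm.1 (h (mem_star_comm.2 h2))
      rwa [← expMod_add_expDiv q e, h1, support_add_smul hq, Finset.union_comm]
    · rfl

theorem monoOp_mono_self {q : ℕ} (hq : 0 < q) {a f : V →₀ ℕ} (ha : ∀ i, a i < q)
    (h : star K f.support ⊆ star K a.support) :
    monoOp k K q a f (mono k K a) = mono k K f := by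
  rw [monoOp_mono hq h, if_pos (expMod_of_lt ha), expDiv_of_lt ha, smul_zero, add_zero]

theorem monoOp_mono_of_ne {q : ℕ} (hq : 0 < q) {a f c : V →₀ ℕ} (hc : ∀ i, c i < q) (hca : c ≠ a)
    (h : star K f.support ⊆ star K a.support) :
    monoOp k K q a f (mono k K c) = 0 := by
  rw [monoOp_mono hq h, if_neg (by rwa [expMod_of_lt hc])]

theorem monoOp_mul_mono {q : ℕ} (hq : 0 < q) {a f : V →₀ ℕ}
    (h : star K f.support ⊆ star K a.support) (d : V →₀ ℕ) (x : FaceRing k K) :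
    monoOp k K q a f (mono k K (q • d) * x) = mono k K (q • d) * monoOp k K q a f x := by
  refine DFunLike.congr_fun (f := monoOp k K q a f ∘ₗ LinearMap.mulLeft k (mono k K (q • d)))
    (g := LinearMap.mulLeft k (mono k K (q • d)) ∘ₗ monoOp k K q a f) (hom_ext fun e => ?_) x
  simp only [LinearMap.comp_apply, LinearMap.mulLeft_apply, mono_mul_mono, monoOp_mono hq h,
    expMod_smul_add, expDiv_smul_add hq]
  split_ifs with h1
  · rw [mono_mul_mono]
    congr 1
    rw [smul_add]
    abel
  · rw [mul_zero]

variable (p : ℕ) [Fact p.Prime] [CharP k p]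

theorem powLinear_monoOp (s : ℕ) {a f : V →₀ ℕ} (h : star K f.support ⊆ star K a.support) :
    PowLinear (p ^ s) (monoOp k K (p ^ s) a f) :=
  powLinear_of_commute_generators p adjoin_range_mono_single fun i y => by
    rw [mono_pow, monoOp_mul_mono (pow_pos (Fact.out : p.Prime).pos s) h]

theorem monoOp_mem_diffOps [Fintype V] (s : ℕ) {a f : V →₀ ℕ}
    (h : star K f.support ⊆ star K a.support) :
    monoOp k K (p ^ s) a f ∈ diffOps k (FaceRing k K) :=
  mem_diffOps_of_commute_generators p (s := s) adjoin_range_mono_single fun i y => by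
    rw [mono_pow, monoOp_mul_mono (pow_pos (Fact.out : p.Prime).pos s) h]

theorem monoOp_mul_monoOp (s : ℕ) {a b f : V →₀ ℕ} (ha : ∀ i, a i < p ^ s)
    (hb : ∀ i, b i < p ^ s) (hab : star K b.support ⊆ star K a.support)
    (hbf : star K f.support ⊆ star K b.support) :
    monoOp k K (p ^ s) b f * monoOp k K (p ^ s) a b = monoOp k K (p ^ s) a f := by
  have hq : 0 < p ^ s := pow_pos (Fact.out : p.Prime).pos s
  refine PowLinear.ext hq ((powLinear_monoOp p s hbf).mul (powLinear_monoOp p s hab))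
    (powLinear_monoOp p s (hbf.trans hab)) fun c hc => ?_
  rw [Module.End.mul_apply]
  rcases eq_or_ne c a with rfl | hca
  · rw [monoOp_mono_self hq ha hab, monoOp_mono_self hq hb hbf,
      monoOp_mono_self hq ha (hbf.trans hab)]
  · rw [monoOp_mono_of_ne hq hc hca hab, monoOp_mono_of_ne hq hc hca (hbf.trans hab), map_zero]

/-- φ is determined by its values on the finitely many x^a with all exponents below q, and each
value is a finite sum of monomials. Since f is not required to be reduced mod q, constant
coefficients suffice and S need only be a k-subspace. -/
theorem PowLinear.mem_of_monoOp_mem [Fintype V] {s : ℕ} {φ : Module.End k (FaceRing k K)}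
    (hφ : PowLinear (p ^ s) φ) (S : Submodule k (Module.End k (FaceRing k K)))
    (h : ∀ a f : V →₀ ℕ, (∀ i, a i < p ^ s) → faceCoeff K f (φ (mono k K a)) ≠ 0 →
      monoOp k K (p ^ s) a f ∈ S) : φ ∈ S := by
  have hq : 0 < p ^ s := pow_pos (Fact.out : p.Prime).pos s
  choose t ht _ hsum using fun a : V →₀ ℕ => exists_eq_sum_mono (φ (mono k K a))
  let B : Finset (V →₀ ℕ) := Finset.Iic (Finsupp.equivFunOnFinite.symm fun _ => p ^ s - 1)
  have hB : ∀ a, a ∈ B ↔ ∀ i, a i < p ^ s := fun a => by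
    rw [Finset.mem_Iic, Finsupp.le_def]
    exact forall_congr' fun i => by
      rw [Finsupp.equivFunOnFinite_symm_apply_apply]
      omega
  have hst : ∀ a, ∀ f ∈ t a, star K f.support ⊆ star K a.support := fun a f hf =>
    hφ.star_subset hq (ht a f hf)
  have key : φ = ∑ a ∈ B, ∑ f ∈ t a,
      faceCoeff K f (φ (mono k K a)) • monoOp k K (p ^ s) a f := by
    refine PowLinear.ext hq hφ (fun r x => ?_) fun c hc => ?_
    · simp only [LinearMap.sum_apply, LinearMap.smul_apply, Finset.mul_sum]
      refine Finset.sum_congr rfl fun a _ => Finset.sum_congr rfl fun f hf => ?_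
      rw [powLinear_monoOp p s (hst a f hf), mul_smul_comm]
    · simp only [LinearMap.sum_apply, LinearMap.smul_apply]
      rw [Finset.sum_eq_single c, hsum c]
      · refine Finset.sum_congr rfl fun f hf => ?_
        rw [monoOp_mono_self hq hc (hst c f hf), ← hsum c]
      · refine fun a _ hac => Finset.sum_eq_zero fun f hf => ?_
        rw [monoOp_mono_of_ne hq hc hac.symm (hst a f hf), smul_zero]
      · exact fun h' => absurd ((hB c).2 hc) h'
  rw [key]
  exact Submodule.sum_mem _ fun a ha => Submodule.sum_mem _ fun f hf =>
    Submodule.smul_mem _ _ (h a f ((hB a).1 ha) (ht a f hf))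

end MonomialOperators

/-! ### Two-sided ideals and the stars of output monomials -/

section Ideals

/-- A two-sided ideal of a subalgebra of `End_k(R)`, as a subspace of `End_k(R)`. -/
def idealSubmodule {k A : Type*} [CommRing k] [Ring A] [Algebra k A] {D : Subalgebra k A}
    (I : TwoSidedIdeal D) : Submodule k A where
  carrier := {φ | ∃ h : φ ∈ D, (⟨φ, h⟩ : D) ∈ I}
  zero_mem' := ⟨D.zero_mem, I.zero_mem⟩
  add_mem' := fun ⟨h, hφ⟩ ⟨h', hψ⟩ => ⟨D.add_mem h h', I.add_mem hφ hψ⟩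
  smul_mem' := fun c φ ⟨h, hφ⟩ => ⟨D.smul_mem h c, by
    have := I.mul_mem_left (algebraMap k D c) _ hφ
    rwa [← Algebra.smul_def] at this⟩

section

variable {k A : Type*} [CommRing k] [Ring A] [Algebra k A] {D : Subalgebra k A}
  {I J : TwoSidedIdeal D}

theorem coe_mem_idealSubmodule {d : D} : (d : A) ∈ idealSubmodule I ↔ d ∈ I :=
  ⟨fun ⟨_, h⟩ => h, fun h => ⟨d.2, h⟩⟩

theorem mul_mem_idealSubmodule_left {φ ψ : A} (hφ : φ ∈ D) (hψ : ψ ∈ idealSubmodule I) :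
    φ * ψ ∈ idealSubmodule I :=
  ⟨D.mul_mem hφ hψ.1, I.mul_mem_left ⟨φ, hφ⟩ _ hψ.2⟩

theorem mul_mem_idealSubmodule_right {φ ψ : A} (hφ : φ ∈ idealSubmodule I) (hψ : ψ ∈ D) :
    φ * ψ ∈ idealSubmodule I :=
  ⟨D.mul_mem hφ.1 hψ, I.mul_mem_right _ ⟨ψ, hψ⟩ hφ.2⟩

theorem idealSubmodule_mono (h : I ≤ J) : idealSubmodule I ≤ idealSubmodule J :=
  fun _ ⟨hφ, hI⟩ => ⟨hφ, h hI⟩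

end

variable {k : Type*} [Field k] (p : ℕ) [Fact p.Prime] [CharP k p] {V : Type*} [DecidableEq V]
  {K : Complex V}

/-- The differential operators whose values are combinations of monomials `x^g` with
`st(supp g) ⊆ L` form a two-sided ideal. -/
noncomputable def rangeIdeal (k : Type*) [Field k] (p : ℕ) [Fact p.Prime] [CharP k p]
    (K : Complex V) (L : Set (Finset V)) :
    TwoSidedIdeal (diffOps k (FaceRing k K)) :=
  TwoSidedIdeal.mk' {φ | ∀ e g, faceCoeff K g (φ.1 (mono k K e)) ≠ 0 → star K g.support ⊆ L}
    (fun e g h => absurd (by simp) h)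
    (fun {φ ψ} hφ hψ e g h => by
      by_cases h1 : faceCoeff K g (φ.1 (mono k K e)) = 0
      · refine hψ e g fun h2 => h ?_
        change faceCoeff K g (φ.1 (mono k K e) + ψ.1 (mono k K e)) = 0
        rw [map_add, h1, h2, add_zero]
      · exact hφ e g h1)
    (fun {φ} hφ e g h => hφ e g fun h1 => h (by
      change faceCoeff K g (-φ.1 (mono k K e)) = 0
      rw [map_neg, h1, neg_zero]))
    -- Composing on the left can only shrink the stars of output monomials; composing on the right
    -- merely changes the inputs.
    (fun {φ ψ} hψ e g h => by
      obtain ⟨f, hf, hg⟩ := exists_faceCoeff_ne_zero (φ := φ.1) h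
      obtain ⟨s, hs⟩ := exists_powLinear_of_mem_diffOps p φ.2
      exact (hs.star_subset (pow_pos (Fact.out : p.Prime).pos s) hg).trans (hψ e f hf))
    (fun {φ ψ} hφ e g h => by
      obtain ⟨f, hf, hg⟩ := exists_faceCoeff_ne_zero (φ := φ.1) h
      exact hφ f g hg)

theorem mem_rangeIdeal {L : Set (Finset V)} {φ : diffOps k (FaceRing k K)} :
    φ ∈ rangeIdeal k p K L ↔
      ∀ e g, faceCoeff K g (φ.1 (mono k K e)) ≠ 0 → star K g.support ⊆ L :=
  TwoSidedIdeal.mem_mk' ..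

/-- Multiplying by ring elements enlarges supports and so shrinks stars; hence every monomial
occurring in an element of M^q_L has star inside L. -/
theorem idealJ_le_rangeIdeal (L : Set (Finset V)) : idealJ k p K L ≤ rangeIdeal k p K L := by
  refine iSup_le fun r => TwoSidedIdeal.span_le.2 ?_
  rintro φ ⟨ψ, hφ, hψ, -⟩
  refine (mem_rangeIdeal p).2 fun e g h => ?_
  rw [hφ, LinearMap.restrictScalars_apply] at h
  have key : ∀ x ∈ starModule k K (p ^ r) L, ∀ g, faceCoeff K g x ≠ 0 →
      star K g.support ⊆ L := by
    intro x hx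
    induction hx using Submodule.span_induction with
    | mem x hx =>
      obtain ⟨a, -, -, rfl, rfl⟩ := hx
      intro g hg
      rw [not_imp_comm.1 faceCoeff_mono_of_ne hg]
    | zero => intro g hg; simp at hg
    | add x y _ _ hx hy =>
      intro g hg
      by_cases h1 : faceCoeff K g x = 0
      · exact hy g (by simpa [h1] using hg)
      · exact hx g h1
    | smul s x _ hx =>
      intro g hg
      obtain ⟨f, hf, hgf⟩ := exists_star_subset_of_faceCoeff_mul_ne_zero (r := (s : FaceRing k K)) hg
      exact hgf.trans (hx f hf)
  exact key _ (hψ _) g h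

theorem idealJ_inf_idealJ_eq_bot {σ τ : Finset V} (hστ : σ ∪ τ ∉ K.faces) :
    idealJ k p K (star K σ) ⊓ idealJ k p K (star K τ) = ⊥ := by
  refine le_bot_iff.1 fun φ hφ => ?_
  obtain ⟨h1, h2⟩ := (TwoSidedIdeal.mem_inf ..).1 hφ
  have h1 := (mem_rangeIdeal p).1 (idealJ_le_rangeIdeal p _ h1)
  have h2 := (mem_rangeIdeal p).1 (idealJ_le_rangeIdeal p _ h2)
  rw [TwoSidedIdeal.mem_bot]
  refine Subtype.ext (hom_ext fun e => ?_)
  obtain ⟨s, hs, -, hsum⟩ := exists_eq_sum_mono (φ.1 (mono k K e))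
  rcases s.eq_empty_or_nonempty with rfl | ⟨g, hg⟩
  · rw [hsum]; rfl
  · have hgne := hs g hg
    have h := star_subset_union (ρ := τ) (h1 e g hgne)
    rw [star_union_eq (h2 e g hgne)] at h
    exact absurd (mem_faces_of_star_subset (mem_faces_of_faceCoeff_ne_zero hgne) h) hστ

/-! ### Identification of J(st(σ)) and decomposition of arbitrary ideals -/

variable [Fintype V]

/-- This operator projects onto R^q · x^a along the other reduced monomials, so it lies in the
diagonal block of its star. -/
theorem monoOp_mem_idealJ {r : ℕ} {a : V →₀ ℕ} (ha : ∀ i, a i < p ^ r)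
    (haK : a.support ∈ K.faces) :
    monoOp k K (p ^ r) a a ∈ idealSubmodule (idealJ k p K (star K a.support)) := by
  have hq : 0 < p ^ r := pow_pos (Fact.out : p.Prime).pos r
  refine ⟨monoOp_mem_diffOps p r subset_rfl, ?_⟩
  refine (le_iSup (fun r => idealJq k K (p ^ r) (star K a.support) (star K a.support)) r :)
    (TwoSidedIdeal.subset_span ?_)
  let ψ : Module.End (powSubring k K (p ^ r)) (FaceRing k K) :=
    { toFun := monoOp k K (p ^ r) a a
      map_add' := map_add _
      map_smul' := fun s x =>
        (powLinear_monoOp p r (subset_refl (star K a.support))).map_powSubring_mul s.2 x }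
  have hψ : ∀ x, ψ x = monoOp k K (p ^ r) a a x := fun _ => rfl
  refine ⟨ψ, rfl, fun x => ?_, fun σ _ hσ x hx => ?_⟩
  · have hx : x ∈ Submodule.span k (Set.range (mono k K)) := by
      rw [span_range_mono]
      exact Submodule.mem_top
    rw [hψ]
    induction hx using Submodule.span_induction with
    | mem x hx =>
      obtain ⟨e, rfl⟩ := hx
      rw [monoOp_mono hq subset_rfl]
      split_ifs
      · rw [add_comm, ← mono_mul_mono]
        exact Submodule.smul_mem _ (⟨_, mono_smul_mem_powSubring _ _⟩ : powSubring k K (p ^ r))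
          (Submodule.subset_span ⟨a, ha, haK, rfl, rfl⟩)
      · exact Submodule.zero_mem _
    | zero => rw [map_zero]; exact Submodule.zero_mem _
    | add x y _ _ hx hy => rw [map_add]; exact Submodule.add_mem _ hx hy
    | smul c x _ hx => rw [map_smul]; exact Submodule.smul_of_tower_mem _ c hx
  · induction hx using Submodule.span_induction with
    | mem x hx =>
      obtain ⟨b, hb, -, hbσ, rfl⟩ := hx
      exact monoOp_mono_of_ne hq hb (fun hba => hσ (by rw [← hbσ, hba])) subset_rfl
    | zero => rw [map_zero]
    | add x y _ _ hx hy => rw [map_add, hx, hy, add_zero]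
    | smul c x _ hx => rw [map_smul, hx, smul_zero]

/-- If a two-sided ideal contains the projection onto the summand `R^q · x^y`, then it contains
every differential operator with values in the span of the monomials `x^g` with
`st(supp g) ⊆ st(supp y)`. -/
theorem rangeIdeal_le_of_monoOp_mem {I : TwoSidedIdeal (diffOps k (FaceRing k K))} {s : ℕ}
    {y : V →₀ ℕ} (hy : ∀ i, y i < p ^ s) (h : monoOp k K (p ^ s) y y ∈ idealSubmodule I) :
    rangeIdeal k p K (star K y.support) ≤ I := by
  intro φ hφ
  rw [mem_rangeIdeal] at hφ
  rw [← coe_mem_idealSubmodule]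
  obtain ⟨t, ht⟩ := exists_powLinear_of_mem_diffOps p φ.2
  have hp := (Fact.out : p.Prime).two_le
  have hq0 : 0 < p ^ s := pow_pos (by omega) s
  have hsq : 2 * p ^ s ≤ p ^ (s + 1 + t) := by
    calc 2 * p ^ s ≤ p * p ^ s := Nat.mul_le_mul_right _ hp
      _ = p ^ (s + 1) := (pow_succ' p s).symm
      _ ≤ p ^ (s + 1 + t) := Nat.pow_le_pow_right (by omega) (by omega)
  have hq : 0 < p ^ (s + 1 + t) := by omega
  have ht' := ht.of_dvd (pow_dvd_pow p (by omega : t ≤ s + 1 + t))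
  refine ht'.mem_of_monoOp_mem p _ fun a g ha hg => ?_
  have hga := ht'.star_subset hq hg
  have hgy := hφ a g hg
  -- The vector b is congruent to y mod p ^ s, so the given projection fixes x^b. Since st(g) ⊆
  -- st(y), it has the star of g. Its entries are below 2 * p ^ s, hence reduced for the larger
  -- power of p.
  let b := y + p ^ s • squareFree (g.support ∪ y.support)
  have hbs : star K b.support = star K g.support := by
    rw [support_add_smul hq0, support_squareFree, Finset.union_comm g.support, ← Finset.union_assoc,
      Finset.union_idempotent, Finset.union_comm, star_union_eq hgy]
  have hb : ∀ i, b i < p ^ (s + 1 + t) := fun i => by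
    have h1 := hy i
    have h2 : p ^ s * squareFree (g.support ∪ y.support) i ≤ p ^ s * 1 := by
      refine Nat.mul_le_mul_left _ ?_
      rw [squareFree_apply]
      split_ifs <;> simp
    change y i + p ^ s * squareFree (g.support ∪ y.support) i < _
    omega
  have hdvd := pow_dvd_pow p (by omega : s ≤ s + 1 + t)
  have hbb : monoOp k K (p ^ (s + 1 + t)) b b ∈ idealSubmodule I := by
    have h1 : monoOp k K (p ^ (s + 1 + t)) b b =
        monoOp k K (p ^ s) y y * monoOp k K (p ^ (s + 1 + t)) b b := by
      refine PowLinear.ext hq (powLinear_monoOp p _ subset_rfl)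
        (((powLinear_monoOp p s subset_rfl).of_dvd hdvd).mul (powLinear_monoOp p _ subset_rfl))
        fun c hc => ?_
      rw [Module.End.mul_apply]
      rcases eq_or_ne c b with rfl | hcb
      · rw [monoOp_mono_self hq hb subset_rfl, (powLinear_monoOp p s subset_rfl).mono_add_smul,
          monoOp_mono_self hq0 hy subset_rfl, mono_mul_mono, add_comm]
      · rw [monoOp_mono_of_ne hq hc hcb subset_rfl, map_zero]
    rw [h1]
    exact mul_mem_idealSubmodule_right h (monoOp_mem_diffOps p _ subset_rfl)
  have hba : star K b.support ⊆ star K a.support := hbs.trans_subset hga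
  -- The unit a → g factors as a → b → b → g, and its middle factor lies in I.
  rw [← monoOp_mul_monoOp p _ ha hb hba hbs.symm.subset, ← monoOp_mul_monoOp p _ ha hb hba subset_rfl]
  exact mul_mem_idealSubmodule_left (monoOp_mem_diffOps p _ hbs.symm.subset)
    (mul_mem_idealSubmodule_right hbb (monoOp_mem_diffOps p _ hba))

/-- `J(st(σ))` consists of the differential operators with values in the span of the monomials
`x^g` with `st(supp g) ⊆ st(σ)`. -/
theorem idealJ_eq_rangeIdeal {σ : Finset V} (hσ : σ ∈ K.faces) :
    idealJ k p K (star K σ) = rangeIdeal k p K (star K σ) := by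
  refine le_antisymm (idealJ_le_rangeIdeal p _) ?_
  have hp := (Fact.out : p.Prime).one_lt
  -- Already q = p suffices, since square-free exponents are at most 1.
  have h1 : ∀ i, squareFree σ i < p ^ 1 := fun i => by
    rw [squareFree_apply, pow_one]
    split_ifs <;> omega
  have h2 := monoOp_mem_idealJ (k := k) (K := K) p h1 (by rwa [support_squareFree])
  have h3 := rangeIdeal_le_of_monoOp_mem p h1 h2
  rwa [support_squareFree] at h3

/-- Composing φ with matrix units on both sides isolates the coefficient of x^f, as with full matrix
rings; this puts a projection with star st(f) into I. -/
theorem idealJ_le_of_faceCoeff_ne_zero {I : TwoSidedIdeal (diffOps k (FaceRing k K))}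
    {φ : diffOps k (FaceRing k K)} (hφ : φ ∈ I) {a f : V →₀ ℕ}
    (h : faceCoeff K f (φ.1 (mono k K a)) ≠ 0) : idealJ k p K (star K f.support) ≤ I := by
  obtain ⟨s, hs⟩ := exists_powLinear_of_mem_diffOps p φ.2
  have hp := (Fact.out : p.Prime).one_lt
  have hq : 0 < p ^ s := pow_pos (by omega) s
  have hfa := hs.star_subset hq h
  obtain ⟨u, -, hu, hsum⟩ := exists_eq_sum_mono (φ.1 (mono k K a))
  obtain ⟨c, hcf, hsum⟩ : ∃ c : (V →₀ ℕ) → k, c f = faceCoeff K f (φ.1 (mono k K a)) ∧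
      φ.1 (mono k K a) = ∑ e ∈ u, c e • mono k K e := ⟨_, rfl, hsum⟩
  have hfu := hu f h
  rw [← hcf] at h
  -- φ commutes with x^d. The shift leaves supp(f) unchanged and, as st(f) ⊆ st(a), gives a + d the
  -- star of f, so the unit f + d → a + d exists.
  let d := p ^ s • squareFree f.support
  have hfd : (f + d).support = f.support := by
    rw [support_add_smul hq, support_squareFree, Finset.union_idempotent]
  have had : star K (a + d).support = star K f.support := by
    rw [support_add_smul hq, support_squareFree, Finset.union_comm, star_union_eq hfa]
  -- With t this large, all shifted exponents are reduced mod p ^ t, so the projection onto f + d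
  -- annihilates every other term of x^d φ(x^a).
  obtain ⟨t, hst, ht⟩ : ∃ t, s ≤ t ∧ ∀ g ∈ insert a u, ∀ i, (g + d) i < p ^ t := by
    refine ⟨s + ∑ g ∈ insert a u, ∑ i, (g + d) i, by omega, fun g hg i => ?_⟩
    refine lt_of_le_of_lt ?_ (Nat.lt_pow_self hp)
    refine le_trans ?_ (Nat.le_add_left _ _)
    exact (Finset.single_le_sum (f := fun i => (g + d) i) (fun _ _ => Nat.zero_le _)
      (Finset.mem_univ i)).trans (Finset.single_le_sum (f := fun g => ∑ i, (g + d) i)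
        (fun _ _ => Nat.zero_le _) hg)
  have hq' : 0 < p ^ t := pow_pos (by omega) t
  have hft := ht f (Finset.mem_insert_of_mem hfu)
  have hat := ht a (Finset.mem_insert_self _ _)
  have hst1 : star K (a + d).support ⊆ star K (f + d).support := by rw [had, hfd]
  have key : monoOp k K (p ^ t) (f + d) (f + d) = (c f)⁻¹ •
      (monoOp k K (p ^ t) (f + d) (f + d) * (φ.1 * monoOp k K (p ^ t) (f + d) (a + d))) := by
    have hlin := (powLinear_monoOp (k := k) p t (subset_refl (star K (f + d).support))).mul
      ((hs.of_dvd (pow_dvd_pow p hst)).mul (powLinear_monoOp p t hst1))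
    refine PowLinear.ext hq' (powLinear_monoOp p t subset_rfl) (fun r x => ?_) fun b hb => ?_
    · rw [LinearMap.smul_apply, hlin, LinearMap.smul_apply, mul_smul_comm]
    · rw [LinearMap.smul_apply, Module.End.mul_apply, Module.End.mul_apply]
      rcases eq_or_ne b (f + d) with rfl | hbf
      · rw [monoOp_mono_self hq' hft subset_rfl, monoOp_mono_self hq' hft hst1, hs.mono_add_smul,
          hsum, Finset.mul_sum, map_sum, Finset.sum_eq_single f, mul_smul_comm, map_smul,
          mono_mul_mono, add_comm _ f, monoOp_mono_self hq' hft subset_rfl, smul_smul,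
          inv_mul_cancel₀ h, one_smul]
        · intro g hg hgf
          rw [mul_smul_comm, map_smul, mono_mul_mono, add_comm _ g,
            monoOp_mono_of_ne hq' (ht g (Finset.mem_insert_of_mem hg))
              (fun h' => hgf (add_right_cancel h')) subset_rfl, smul_zero]
        · exact fun h' => absurd hfu h'
      · rw [monoOp_mono_of_ne hq' hb hbf subset_rfl, monoOp_mono_of_ne hq' hb hbf hst1, map_zero,
          map_zero, smul_zero]
  have hmem : monoOp k K (p ^ t) (f + d) (f + d) ∈ idealSubmodule I := by
    rw [key]
    exact Submodule.smul_mem _ _ (mul_mem_idealSubmodule_left (monoOp_mem_diffOps p t subset_rfl)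
      (mul_mem_idealSubmodule_right (coe_mem_idealSubmodule.2 hφ) (monoOp_mem_diffOps p t hst1)))
  have := (idealJ_le_rangeIdeal p _).trans (rangeIdeal_le_of_monoOp_mem p hft hmem)
  rwa [hfd] at this

/-- Each matrix unit a → f occurring in φ ∈ I has outputs x^(f + qd), so it lies in J(st(f)), which
is contained in I. -/
theorem eq_iSup_idealJ (I : TwoSidedIdeal (diffOps k (FaceRing k K))) :
    I = ⨆ σ : {σ : Finset V // σ ∈ K.faces ∧ idealJ k p K (star K σ) ≤ I},
      idealJ k p K (star K σ.1) := by
  refine le_antisymm (fun φ hφ => ?_) (iSup_le fun σ => σ.2.2)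
  rw [← coe_mem_idealSubmodule]
  obtain ⟨s, hs⟩ := exists_powLinear_of_mem_diffOps p φ.2
  have hq : 0 < p ^ s := pow_pos (Fact.out : p.Prime).pos s
  refine hs.mem_of_monoOp_mem p _ fun a f ha hf => ?_
  have hfK := mem_faces_of_faceCoeff_ne_zero hf
  have hfa := hs.star_subset hq hf
  have hle := idealJ_le_of_faceCoeff_ne_zero p hφ hf
  refine idealSubmodule_mono
    (le_iSup (fun σ : {σ : Finset V // σ ∈ K.faces ∧ idealJ k p K (star K σ) ≤ I} =>
      idealJ k p K (star K σ.1)) ⟨f.support, hfK, hle⟩) ?_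
  refine ⟨monoOp_mem_diffOps p s hfa, ?_⟩
  rw [idealJ_eq_rangeIdeal p hfK, mem_rangeIdeal]
  intro e g hg
  dsimp only at hg
  classical
  rw [monoOp_mono hq hfa] at hg
  split_ifs at hg
  · rw [← not_imp_comm.1 faceCoeff_mono_of_ne hg, support_add_smul hq]
    exact star_mono_right Finset.subset_union_left
  · simp at hg

theorem idealJ_inf_idealJ {σ τ : Finset V} (hσ : σ ∈ K.faces) (hτ : τ ∈ K.faces)
    (hστ : σ ∪ τ ∈ K.faces) :
    idealJ k p K (star K σ) ⊓ idealJ k p K (star K τ) = idealJ k p K (star K (σ ∪ τ)) := by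
  rw [idealJ_eq_rangeIdeal p hσ, idealJ_eq_rangeIdeal p hτ, idealJ_eq_rangeIdeal p hστ]
  ext φ
  simp only [TwoSidedIdeal.mem_inf, mem_rangeIdeal]
  constructor
  · rintro ⟨h1, h2⟩ e g hg
    have h := star_subset_union (ρ := τ) (h1 e g hg)
    rwa [star_union_eq (h2 e g hg)] at h
  · exact fun h => ⟨fun e g hg => (h e g hg).trans (star_mono_right Finset.subset_union_left),
      fun e g hg => (h e g hg).trans (star_mono_right Finset.subset_union_right)⟩

end Ideals

end StanleyReisner

theorem mainTheorem9 {k : Type*} [Field k] (p : ℕ) [Fact p.Prime] [CharP k p]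
    {V : Type*} [Fintype V] [DecidableEq V] (K : StanleyReisner.Complex V) :
    latticeClosure
        (insert ⊥ {I | ∃ σ ∈ K.faces,
          I = StanleyReisner.idealJ k p K (StanleyReisner.star K σ)}) = Set.univ ∧
    (∀ σ ∈ K.faces, ∀ τ ∈ K.faces, σ ∪ τ ∈ K.faces →
      StanleyReisner.idealJ k p K (StanleyReisner.star K σ) ⊓
          StanleyReisner.idealJ k p K (StanleyReisner.star K τ) =
        StanleyReisner.idealJ k p K (StanleyReisner.star K (σ ∪ τ))) ∧
    (∀ σ ∈ K.faces, ∀ τ ∈ K.faces, σ ∪ τ ∉ K.faces →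
      StanleyReisner.idealJ k p K (StanleyReisner.star K σ) ⊓
          StanleyReisner.idealJ k p K (StanleyReisner.star K τ) = ⊥) := by
  classical
  refine ⟨Set.eq_univ_of_forall fun I => ?_,
    fun σ hσ τ hτ h => StanleyReisner.idealJ_inf_idealJ p hσ hτ h,
    fun σ _ τ _ h => StanleyReisner.idealJ_inf_idealJ_eq_bot p h⟩
  -- There are finitely many faces, so the supremum is a finite join; ⊥ accounts for the empty one.
  rw [StanleyReisner.eq_iSup_idealJ p I, ← Finset.sup_univ_eq_iSup]
  refine Finset.sup_mem _ (subset_latticeClosure (Set.mem_insert _ _))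
    (fun x hx y hy => isSublattice_latticeClosure.1 hx hy) _ _ fun σ _ =>
      subset_latticeClosure (Set.mem_insert_of_mem _ ⟨σ.1, σ.2.1, rfl⟩)
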